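/- Let $\mathscr{M}$ be a combinatorial model category (locally presentable and cofibrantly generated). For a small category $\mathcal{J}$ and an object $e\in\mathcal{J}$, let $\mathbf{F}^e:\mathscr{M}\to \mathrm{Hom}(\mathcal{J},\mathscr{M})$, $\mathbf{F}^e_U(j)=\coprod_{e\to j}U$, denote the left adjoint of the evaluation at $e$, and for a set $K$ of maps of $\mathscr{M}$ put $\mathbf{F}^e(K)=\{\mathbf{F}^e_f : f\in K\}$. A functor is left Quillen if it is a left adjoint and preserves cofibrations and trivial cofibrations. (1) Let $\mathcal{J}$ be a small category with an initial object $e$ such that the comma category $\mathcal{J}\downarrow e$ is reduced to $\mathrm{Id}_e$ (the only morphism of $\mathcal{J}$ with target $e$ is $\mathrm{Id}_e$). Then there is a combinatorial model structure $\mathrm{Hom}(\mathcal{J},\mathscr{M})_{easy}$ on $\mathrm{Hom}(\mathcal{J},\mathscr{M})$ in which a map $\sigma$ is a weak equivalence (resp. a fibration) if and only if the component $\sigma_e$ is a weak equivalence (resp. a fibration) in $\mathscr{M}$. If $\mathbf{I}$ and $\mathbf{J}$ are any generating sets of cofibrations and of trivial cofibrations for $\mathscr{M}$, then $\mathbf{F}^e(\mathbf{I})$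 and $\mathbf{F}^e(\mathbf{J})$ are generating sets of cofibrations and of trivial cofibrations for $\mathrm{Hom}(\mathcal{J},\mathscr{M})_{easy}$, and its cofibrations are the maps with the left lifting property against all maps having the right lifting property against $\mathbf{F}^e(\mathbf{I})$. Moreover the projective model structure $\mathrm{Hom}(\mathcal{J},\mathscr{M})_{proj}$, with objectwise weak equivalences and fibrations, exists, and the identity functor $\mathrm{Id}:\mathrm{Hom}(\mathcal{J},\mathscr{M})_{easy}\to\mathrm{Hom}(\mathcal{J},\mathscr{M})_{proj}$ is left Quillen. (2) Let $X$ be a set and $A,B\in X$. Let $\mathcal{S}_X(A,B)$ be the category whose objects are the sequences $(A_0,\dots,A_n)$ of elements of $X$ with $n\ge 1$, $A_0=A$, $A_n=B$, and whose morphisms $(A_0,\dots,A_n)\to(B_0,\dots,B_m)$ are the surjective nondecreasing maps $f:\{0,\dots,n-1\}\to\{0,\dots,m-1\}$ such that $B_k=A_{\min f^{-1}(k)}$ for all $k<m$. Then all the conclusions of (1) hold for $\mathcal{J}=\mathcal{S}_X(A,B)^{op}$ and $e=(A,B)$. -/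

import Mathlib

open CategoryTheory Limits Opposite HomotopicalAlgebra

universe w v u v₁ u₁ v₂ u₂

namespace EasyModel

/-! ### Combinatorial model categories and left Quillen functors -/

section ModelCategories

variable {C : Type u} [Category.{v} C]

/-- `I` and `J` are generating (`w`-small) sets of cofibrations and of trivial cofibrations of the
model category `C`: both permit the small object argument (this includes that they are `w`-small),
the fibrations are the `J`-injective maps and the trivial fibrations are the `I`-injective maps. -/
structure IsGeneratedBy (m : ModelCategory C) (I J : MorphismProperty C) : Prop where
  isSmall_cof : MorphismProperty.IsSmall.{w} I
  isSmall_trivCof : MorphismProperty.IsSmall.{w} J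
  smallObject_cof : MorphismProperty.HasSmallObjectArgument.{w} I
  smallObject_trivCof : MorphismProperty.HasSmallObjectArgument.{w} J
  fibrations_eq : fibrations C = J.rlp
  trivialFibrations_eq : trivialFibrations C = I.rlp

/-- A model category is combinatorial if it is locally presentable and cofibrantly generated. -/
class IsCombinatorial (C : Type u) [Category.{v} C] [m : ModelCategory C] : Prop
    extends IsLocallyPresentable.{w} C where
  exists_generators : ∃ I J : MorphismProperty C, IsGeneratedBy.{w} m I J

/-- A locally presentable category is cocomplete. -/
instance hasColimitsOfSize_of_isLocallyPresentable (C : Type u) [Category.{v} C]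
    [IsLocallyPresentable.{w} C] : HasColimitsOfSize.{w, w} C := by
  obtain ⟨κ, _, h⟩ := IsLocallyPresentable.exists_cardinal.{w} C
  exact h.toHasColimitsOfSize

/-- A left Quillen functor: a left adjoint which preserves cofibrations and trivial cofibrations. -/
structure IsLeftQuillen {C : Type u₁} [Category.{v₁} C] {D : Type u₂} [Category.{v₂} D]
    (mC : ModelCategory C) (mD : ModelCategory D) (F : C ⥤ D) : Prop where
  isLeftAdjoint : F.IsLeftAdjoint
  map_cofibrations : cofibrations C ≤ (cofibrations D).inverseImage F
  map_trivialCofibrations : trivialCofibrations C ≤ (trivialCofibrations D).inverseImage F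

end ModelCategories

/-! ### Easy and projective model structures on a category of diagrams -/

section Diagrams

variable {J : Type w} [SmallCategory J] (M : Type u) [Category.{v} M] [ModelCategory M]

/-- The natural transformations whose component at `e` is a weak equivalence. -/
def easyWeakEquivalences (e : J) : MorphismProperty (J ⥤ M) :=
  (weakEquivalences M).inverseImage ((evaluation J M).obj e)

/-- The natural transformations whose component at `e` is a fibration. -/
def easyFibrations (e : J) : MorphismProperty (J ⥤ M) :=
  (fibrations M).inverseImage ((evaluation J M).obj e)

/-- A model structure on `J ⥤ M` is the easy one (with respect to `e`) if its weak equivalences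
and fibrations are detected at the component `e`. -/
structure IsEasy (m : ModelCategory (J ⥤ M)) (e : J) : Prop where
  weakEquivalences_eq : weakEquivalences (J ⥤ M) = easyWeakEquivalences M e
  fibrations_eq : fibrations (J ⥤ M) = easyFibrations M e

variable (J) in
/-- A model structure on `J ⥤ M` is the projective one if its weak equivalences and fibrations
are defined objectwise. -/
structure IsProjective (m : ModelCategory (J ⥤ M)) : Prop where
  weakEquivalences_eq : weakEquivalences (J ⥤ M) = (weakEquivalences M).functorCategory J
  fibrations_eq : fibrations (J ⥤ M) = (fibrations M).functorCategory J

variable {M}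

/-- The set `{F^e_f ; f ∈ I}`, where `F^e`, with `F^e_U(j) = ∐_{e ⟶ j} U`, is the left adjoint of
the evaluation at `e`. -/
noncomputable def freeAt [HasColimitsOfSize.{w, w} M] (e : J) (I : MorphismProperty M) :
    MorphismProperty (J ⥤ M) :=
  I.strictMap (evaluationLeftAdjoint M e)

variable (M) in
/-- `J ⥤ M` has a combinatorial model structure whose weak equivalences and fibrations are detected
at `e`; for all sets `I`, `I'` of generating cofibrations and trivial cofibrations of `M`, the sets
`F^e(I)`, `F^e(I')` are generating ones for it, and its cofibrations are the `F^e(I)`-cofibrations;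
and the identity functor from it to the projective model structure is left Quillen. -/
def AdmitsEasyModelStructure [IsCombinatorial.{w} M] (e : J) : Prop :=
  ∃ easy : ModelCategory (J ⥤ M),
    IsEasy M easy e ∧
    IsCombinatorial.{w} (J ⥤ M) (m := easy) ∧
    (∀ I I' : MorphismProperty M, IsGeneratedBy.{w} ‹ModelCategory M› I I' →
      IsGeneratedBy.{w} easy (freeAt e I) (freeAt e I') ∧
      cofibrations (J ⥤ M) = (freeAt e I).rlp.llp) ∧
    ∃ proj : ModelCategory (J ⥤ M),
      IsProjective J M proj ∧ IsLeftQuillen easy proj (𝟭 (J ⥤ M))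

end Diagrams

/-! ### The categories of chains `S_X(A, B)` -/

/-- The `1`-morphisms `(A₀, …, Aₙ)` of `S_X`, `n ≥ 1`, from `A = A₀` to `B = Aₙ`: finite sequences
of elements of `X`. -/
structure Chain (X : Type w) (A B : X) : Type w where
  /-- the degree `n` of the chain -/
  deg : ℕ
  deg_pos : 0 < deg
  /-- the sequence `A₀, …, Aₙ` -/
  pt : Fin (deg + 1) → X
  pt_zero : pt 0 = A
  pt_last : pt (Fin.last deg) = B

namespace Chain

variable {X : Type w} {A B : X}

/-- The chain `(A, B)`, of degree `1`. -/
def single (A B : X) : Chain X A B where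
  deg := 1
  deg_pos := one_pos
  pt := ![A, B]
  pt_zero := rfl
  pt_last := rfl

/-- The `2`-morphisms of `S_X` from `s = (A₀, …, Aₙ)` to `t = (B₀, …, Bₘ)`. They lie over the
surjective nondecreasing maps `f : {0, …, n - 1} → {0, …, m - 1}`, that is, over the morphisms of
`Δ_epi`. The index `i < n` stands for the step from `Aᵢ` to `Aᵢ₊₁`, and `t` is obtained from `s`
by composing the steps in each fibre of `f`, i.e. by deleting the intermediate letters: the `k`-th
step of `t` starts at `Aᵢ` for the first `i` in the fibre over `k`. -/
@[ext]
structure Hom (s t : Chain X A B) : Type w where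
  /-- the underlying map of ordinals -/
  map : Fin s.deg →o Fin t.deg
  surjective : Function.Surjective map
  pt_map : ∀ i : Fin s.deg, (∀ i' < i, map i' < map i) → t.pt (map i).castSucc = s.pt i.castSucc

/-- The category `S_X(A, B)`, with the composition of maps of ordinals. -/
instance : SmallCategory (Chain X A B) where
  Hom := Hom
  id s :=
    { map := OrderHom.id
      surjective := Function.surjective_id
      pt_map := fun _ _ => rfl }
  comp {s t r} f g :=
    { map := g.map.comp f.map
      surjective := g.surjective.comp f.surjective
      pt_map := by
        intro i hi
        have h₁ : ∀ i' < i, f.map i' < f.map i := fun i' h =>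
          lt_of_not_ge fun h' => absurd (hi i' h) (not_lt.2 (g.map.monotone h'))
        have h₂ : ∀ k < f.map i, g.map k < g.map (f.map i) := by
          intro k hk
          obtain ⟨i', rfl⟩ := f.surjective k
          exact hi i' (lt_of_not_ge fun h' => absurd hk (not_lt.2 (f.map.monotone h')))
        exact (g.pt_map (f.map i) h₂).trans (f.pt_map i h₁) }

end Chain

end EasyModel

/-! Lifting along the evaluations at a small family of objects `d i` gives both model structures:
one object yields the easy structure, all objects the projective one. By adjunction, a map is
injective for the free maps on generators exactly when its components at the `d i` are injective for
the generators. The remaining point is acyclicity: components of free maps are coproducts of the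
original ones (`freeAt_le_inverseImage_evaluation`) and evaluations are cocontinuous, so components
of maps in the saturation of the free trivial cofibrations are trivial cofibrations
(`llp_rlp_le_inverseImage`). Local presentability supplies the small object argument. The identity
is left Quillen because projective (trivial) fibrations are in particular easy ones. -/

namespace EasyModel

open MorphismProperty

/-! ### Small object argument and saturated classes -/

section SmallObjects

/-- In a locally presentable category, a small family of objects consists of `κ`-presentable
objects for some regular cardinal `κ`. -/
lemma exists_isCardinalPresentable {C : Type u} [Category.{v} C] [IsLocallyPresentable.{w} C]
    {ι : Type w} (A : ι → C) :
    ∃ (κ : Cardinal.{w}) (_ : Fact κ.IsRegular), ∀ i, IsCardinalPresentable (A i) κ := by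
  have h (i : ι) : IsPresentable.{w} (A i) := inferInstance
  choose κ hκ hA using fun i ↦ (h i).exists_cardinal
  obtain ⟨κ', hκ', hlt⟩ :=
    HasCardinalLT.exists_regular_cardinal_forall.{w} (fun i ↦ (κ i).ord.ToType)
  have : Fact κ'.IsRegular := ⟨hκ'⟩
  refine ⟨κ', inferInstance, fun i ↦ isCardinalPresentable_of_le (κ := κ i) _ (le_of_lt ?_)⟩
  simpa [hasCardinalLT_iff_cardinal_mk_lt] using hlt i

/-- Any small set of morphisms in a locally presentable category permits the small object
argument. -/
lemma hasSmallObjectArgument {C : Type u} [Category.{v} C] [IsLocallyPresentable.{w} C]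
    [HasPushouts C] (I : MorphismProperty C) [IsSmall.{w} I] :
    HasSmallObjectArgument.{w} I := by
  obtain ⟨ι, A, B, f, rfl⟩ := (isSmall_iff_eq_ofHoms.{w} I).1 inferInstance
  obtain ⟨κ, hκ, hA⟩ := exists_isCardinalPresentable.{w} A
  have : LocallySmall.{w} C := by
    obtain ⟨κ, _, _⟩ := IsLocallyPresentable.exists_cardinal.{w} C
    exact HasCardinalFilteredGenerator.toLocallySmall κ
  have : Nonempty κ.ord.ToType := by simpa using hκ.out.ne_zero
  have := WellFoundedLT.toOrderBot κ.ord.ToType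
  refine ⟨κ, inferInstance, inferInstance, { preservesColimit := ?_ }⟩
  rintro _ _ X Y _ ⟨i⟩ g hg
  have := preservesColimitsOfShape_of_isCardinalPresentable (A i) κ κ.ord.ToType
  infer_instance

/-- Cocontinuous functors preserve saturated classes generated by a set of morphisms. -/
lemma llp_rlp_le_inverseImage {C : Type u₁} [Category.{v₁} C] {D : Type u₂} [Category.{v₂} D]
    (L : C ⥤ D) [PreservesColimitsOfSize.{w, w} L] [PreservesColimitsOfShape WalkingSpan L]
    (I : MorphismProperty C) [HasSmallObjectArgument.{w} I] (T : MorphismProperty D)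
    (h : I ≤ T.llp.inverseImage L) : I.rlp.llp ≤ T.llp.inverseImage L := by
  have hcop : coproducts.{w} I ≤ T.llp.inverseImage L := by
    intro X Y f hf
    obtain ⟨K, hf⟩ := (coproducts_iff _ _).1 hf
    obtain ⟨X₁, X₂, c₁, c₂, h₁, h₂, g, hg⟩ := hf
    refine (T.llp_isStableUnderCoproductsOfShape K).condition _ _ _ _
      (isColimitOfPreserves L h₁) (isColimitOfPreserves L h₂) (Functor.whiskerRight g L)
      (fun j ↦ h _ (hg j)) _ fun j ↦ ?_
    simp [← Functor.map_comp]
  have hpush : (coproducts.{w} I).pushouts ≤ T.llp.inverseImage L := by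
    rintro X Y f ⟨A, B, g, a, b, hg, sq⟩
    exact of_isPushout (P := T.llp) (sq.map L) (hcop _ hg)
  have : PreservesWellOrderContinuousOfShape I.smallObjectκ.ord.ToType L := ⟨inferInstance⟩
  -- The saturation consists of retracts of transfinite compositions of pushouts of coproducts of
  -- maps in `I`; `L` preserves each operation and `T.llp` is closed under it.
  rw [llp_rlp_of_hasSmallObjectArgument']
  rintro X Y f ⟨X', Y', g, r, hg⟩
  refine of_retract (P := T.llp) (r.map L) ?_
  have hg' := transfiniteCompositionsOfShape_monotone _ hpush _ hg
  exact (llp_rlp_llp T).le _ (transfiniteCompositionsOfShape_le_llp_rlp _ _ _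
    (transfiniteCompositionsOfShape_map_of_preserves _ L _ hg'))

end SmallObjects

/-! ### Recognition of cofibrantly generated model structures -/

section Recognition

variable {C : Type u} [Category.{v} C] [HasFiniteLimits C] [HasFiniteColimits C]

/-- Recognition principle for cofibrantly generated model categories: `I` and `I'` are generating
sets of cofibrations and trivial cofibrations, `W` is the class of weak equivalences. -/
@[reducible]
def modelCategoryOfGenerators (W I I' : MorphismProperty C) [W.HasTwoOutOfThreeProperty]
    [HasSmallObjectArgument.{w} I] [HasSmallObjectArgument.{w} I']
    (hI : I.rlp = I'.rlp ⊓ W) (hI' : I'.rlp.llp ≤ W) : ModelCategory C :=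
  letI : CategoryWithFibrations C := ⟨I'.rlp⟩
  letI : CategoryWithCofibrations C := ⟨I.rlp.llp⟩
  letI : CategoryWithWeakEquivalences C := ⟨W⟩
  haveI : (weakEquivalences C).HasTwoOutOfThreeProperty := ‹W.HasTwoOutOfThreeProperty›
  have htf : trivialFibrations C = I.rlp := hI.symm
  have htc : trivialCofibrations C = I'.rlp.llp := by
    refine le_antisymm ?_ (le_inf (antitone_llp (hI.le.trans inf_le_left)) hI')
    rintro X Y f ⟨hf, hfW⟩
    -- Retract argument: two-out-of-three puts the second factor in `I.rlp`, so `f` lifts against it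
    -- and is a retract of the first factor.
    have hfac := factorizationData I'.rlp.llp I'.rlp f
    have hp : I.rlp hfac.p := by
      rw [hI]
      exact ⟨hfac.hp, W.of_precomp hfac.i hfac.p (hI' _ hfac.hi) (by rwa [hfac.fac])⟩
    have := hf _ hp
    exact of_retract (RetractArrow.ofLeftLiftingProperty hfac.fac) hfac.hi
  haveI : IsWeakFactorizationSystem (cofibrations C) (trivialFibrations C) := by
    rw [htf]
    exact { rlp := rlp_llp_rlp I, llp := rfl, hasFactorization :=
      inferInstanceAs (HasFactorization I.rlp.llp I.rlp) }
  haveI : IsWeakFactorizationSystem (trivialCofibrations C) (fibrations C) := by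
    rw [htc]
    exact { rlp := rlp_llp_rlp I', llp := rfl, hasFactorization :=
      inferInstanceAs (HasFactorization I'.rlp.llp I'.rlp) }
  ModelCategory.mk' C

omit [HasFiniteLimits C] [HasFiniteColimits C] in
lemma cofibrations_eq_llp (_ : ModelCategory C) :
    cofibrations C = (trivialFibrations C).llp :=
  (trivialFibrations_llp C).symm

omit [HasFiniteLimits C] [HasFiniteColimits C] in
lemma trivialCofibrations_eq_llp (_ : ModelCategory C) :
    trivialCofibrations C = (fibrations C).llp :=
  (fibrations_llp C).symm

end Recognition

/-! ### Model structures on diagrams detected at a family of objects -/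

section Diagrams

variable {J : Type w} [SmallCategory J] {M : Type u} [Category.{v} M]

instance isLocallyPresentable_functor [IsLocallyPresentable.{w} M] [HasPullbacks M] :
    IsLocallyPresentable.{w} (J ⥤ M) :=
  (opOpEquivalence J).congrLeft.isLocallyPresentable

instance isSmall_freeAt [HasColimitsOfSize.{w, w} M] (e : J) (I : MorphismProperty M)
    [IsSmall.{w} I] : IsSmall.{w} (freeAt e I) := by
  obtain ⟨ι, A, B, f, rfl⟩ := (isSmall_iff_eq_ofHoms.{w} I).1 inferInstance
  have : freeAt e (ofHoms f) = ofHoms fun i ↦ (evaluationLeftAdjoint M e).map (f i) := by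
    refine le_antisymm ?_ ?_
    · rintro _ _ _ ⟨⟨i⟩⟩
      exact ⟨i⟩
    · rintro _ _ _ ⟨i⟩
      exact ⟨⟨i⟩⟩
  rw [this]
  infer_instance

/-- Lifting problems transpose along the adjunction between `F^e` and evaluation at `e`. -/
lemma rlp_freeAt [HasColimitsOfSize.{w, w} M] (e : J) (I : MorphismProperty M) :
    (freeAt e I).rlp = I.rlp.inverseImage ((evaluation J M).obj e) := by
  ext X Y p
  refine ⟨fun hp A B i hi ↦ ?_, ?_⟩
  · exact ((evaluationAdjunctionRight M e).hasLiftingProperty_iff i p).1 (hp _ ⟨hi⟩)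
  · rintro hp _ _ _ ⟨hi⟩
    exact ((evaluationAdjunctionRight M e).hasLiftingProperty_iff _ p).2 (hp _ hi)

lemma rlp_iSup {C : Type*} [Category* C] {ι : Type*} (I : ι → MorphismProperty C) :
    (⨆ i, I i).rlp = ⨅ i, (I i).rlp := by
  ext X Y p
  simp only [iInf_iff]
  refine ⟨fun hp i A B f hf ↦ hp _ ((iSup_iff _ _).2 ⟨i, hf⟩), fun hp A B f hf ↦ ?_⟩
  obtain ⟨i, hf⟩ := (iSup_iff _ _).1 hf
  exact hp i _ hf

/-- The components of `F^e_f` have the left lifting properties of `f`. -/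
lemma freeAt_le_inverseImage_evaluation [HasColimitsOfSize.{w, w} M] (e k : J)
    (I T : MorphismProperty M) (h : I ≤ T.llp) :
    freeAt e I ≤ T.llp.inverseImage ((evaluation J M).obj k) := by
  rintro _ _ _ ⟨hf⟩
  rename_i A B f
  -- The component at `k` of `F^e_f` is the coproduct of copies of `f` indexed by `e ⟶ k`.
  let φ : Discrete.functor (fun _ : e ⟶ k ↦ A) ⟶ Discrete.functor fun _ ↦ B :=
    Discrete.natTrans fun _ ↦ f
  exact (T.llp_isStableUnderCoproductsOfShape (e ⟶ k)).condition _ _ _ _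
    (colimit.isColimit _) (colimit.isColimit _) φ
    (fun _ ↦ h _ hf) _ (fun _ ↦ by simp [φ])

/-- The natural transformations whose components at the objects `d i` belong to `W`. -/
def detectedAt {ι : Type*} (d : ι → J) (W : MorphismProperty M) : MorphismProperty (J ⥤ M) :=
  ⨅ i, W.inverseImage ((evaluation J M).obj (d i))

instance {ι : Type*} (d : ι → J) (W : MorphismProperty M) [W.HasTwoOutOfThreeProperty] :
    (detectedAt d W).HasTwoOutOfThreeProperty where
  comp_mem f g hf hg := by
    simp only [detectedAt, iInf_iff] at hf hg ⊢
    exact fun i ↦ comp_mem _ _ _ (hf i) (hg i)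
  of_postcomp f g hf hg := by
    simp only [detectedAt, iInf_iff] at hf hg ⊢
    exact fun i ↦ of_postcomp _ f g (hf i) (hg i)
  of_precomp f g hf hg := by
    simp only [detectedAt, iInf_iff] at hf hg ⊢
    exact fun i ↦ of_precomp _ f g (hf i) (hg i)

lemma rlp_iSup_freeAt [HasColimitsOfSize.{w, w} M] {ι : Type*} (d : ι → J)
    (I : MorphismProperty M) :
    (⨆ i, freeAt (d i) I).rlp = detectedAt d I.rlp := by
  simp only [rlp_iSup, rlp_freeAt, detectedAt]

variable [ModelCategory M] [IsLocallyPresentable.{w} M]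

lemma exists_modelCategory_detectedAt {ι : Type w} (d : ι → J) {I I' : MorphismProperty M}
    (h : IsGeneratedBy.{w} ‹ModelCategory M› I I') :
    ∃ m : ModelCategory (J ⥤ M), weakEquivalences (J ⥤ M) = detectedAt d (weakEquivalences M) ∧
      fibrations (J ⥤ M) = detectedAt d (fibrations M) := by
  have := h.isSmall_cof
  have := h.isSmall_trivCof
  have := hasSmallObjectArgument.{w} (⨆ i, freeAt (d i) I)
  have := hasSmallObjectArgument.{w} (⨆ i, freeAt (d i) I')
  have (k : J) : PreservesColimitsOfSize.{w, w} ((evaluation J M).obj k) :=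
    ⟨fun {_} _ ↦ inferInstance⟩
  refine ⟨modelCategoryOfGenerators.{w} (detectedAt d (weakEquivalences M))
    (⨆ i, freeAt (d i) I) (⨆ i, freeAt (d i) I') ?_ ?_, rfl, ?_⟩
  · rw [rlp_iSup_freeAt, rlp_iSup_freeAt, ← h.fibrations_eq, ← h.trivialFibrations_eq]
    simp only [detectedAt, ← iInf_inf_eq, ← inverseImage_inf]
    rfl
  -- Acyclicity, with `T` the fibrations of `M`, so that `T.llp` is the class of trivial
  -- cofibrations.
  · refine le_iInf fun k ↦ (llp_rlp_le_inverseImage.{w}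
      ((evaluation J M).obj (d k)) _ (fibrations M)
      (iSup_le fun i ↦ freeAt_le_inverseImage_evaluation _ _ _ _ ?_)).trans ?_
    · rw [h.fibrations_eq]
      exact le_llp_rlp _
    · rw [fibrations_llp]
      exact monotone_inverseImage _ (trivialCofibrations_sub_weakEquivalences M)
  · exact (rlp_iSup_freeAt d I').trans (by rw [h.fibrations_eq])

/-- If fibrations and weak equivalences of a model structure on diagrams are detected at `e`,
it is generated by the free maps at `e` on generators. -/
lemma IsEasy.isGeneratedBy {easy : ModelCategory (J ⥤ M)} {e : J} (he : IsEasy M easy e)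
    {I I' : MorphismProperty M} (h : IsGeneratedBy.{w} ‹ModelCategory M› I I') :
    IsGeneratedBy.{w} easy (freeAt e I) (freeAt e I') := by
  have := h.isSmall_cof
  have := h.isSmall_trivCof
  exact
    { isSmall_cof := inferInstance
      isSmall_trivCof := inferInstance
      smallObject_cof := hasSmallObjectArgument.{w} _
      smallObject_trivCof := hasSmallObjectArgument.{w} _
      fibrations_eq := by rw [rlp_freeAt, ← h.fibrations_eq, he.fibrations_eq]; rfl
      trivialFibrations_eq := by
        rw [rlp_freeAt, ← h.trivialFibrations_eq, trivialFibrations, he.fibrations_eq,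
          he.weakEquivalences_eq]
        rfl }

lemma IsEasy.isCombinatorial {easy : ModelCategory (J ⥤ M)} {e : J} (he : IsEasy M easy e)
    {I I' : MorphismProperty M} (h : IsGeneratedBy.{w} ‹ModelCategory M› I I') :
    IsCombinatorial.{w} (J ⥤ M) where
  exists_generators := ⟨_, _, he.isGeneratedBy h⟩

omit [IsLocallyPresentable.{w} M] in
lemma IsEasy.isLeftQuillen_id {easy proj : ModelCategory (J ⥤ M)} {e : J} (he : IsEasy M easy e)
    (hp : IsProjective J M proj) : IsLeftQuillen easy proj (𝟭 (J ⥤ M)) where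
  isLeftAdjoint := inferInstance
  map_cofibrations := by
    rw [inverseImage_id, cofibrations_eq_llp easy, cofibrations_eq_llp proj]
    refine antitone_llp ?_
    rw [trivialFibrations, trivialFibrations, he.fibrations_eq,
      he.weakEquivalences_eq, hp.fibrations_eq, hp.weakEquivalences_eq]
    exact fun _ _ _ hf ↦ ⟨hf.1 e, hf.2 e⟩
  map_trivialCofibrations := by
    rw [inverseImage_id, trivialCofibrations_eq_llp easy, trivialCofibrations_eq_llp proj]
    refine antitone_llp ?_
    rw [he.fibrations_eq, hp.fibrations_eq]
    exact fun _ _ _ hf ↦ hf e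

end Diagrams

/-- The easy model structure exists for every object `e`: the components of the maps `F^e_f` are
coproducts of copies of `f`, and the evaluation functors preserve colimits. -/
lemma admitsEasyModelStructure {J : Type w} [SmallCategory J] (M : Type u) [Category.{v} M]
    [ModelCategory M] [IsCombinatorial.{w} M] (e : J) : AdmitsEasyModelStructure M e := by
  obtain ⟨I, I', h⟩ := IsCombinatorial.exists_generators (C := M)
  obtain ⟨easy, hW, hF⟩ :=
    exists_modelCategory_detectedAt.{w} (fun _ : PUnit.{w + 1} ↦ e) h
  obtain ⟨proj, hW', hF'⟩ := exists_modelCategory_detectedAt.{w} (fun j : J ↦ j) h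
  have he : IsEasy M easy e :=
    ⟨hW.trans (by simp [detectedAt, easyWeakEquivalences]),
      hF.trans (by simp [detectedAt, easyFibrations])⟩
  have hp : IsProjective J M proj :=
    ⟨hW'.trans (by ext; simp [detectedAt, functorCategory]),
      hF'.trans (by ext; simp [detectedAt, functorCategory])⟩
  refine ⟨easy, he, he.isCombinatorial h, fun K K' hK ↦ ?_,
    proj, hp, he.isLeftQuillen_id hp⟩
  have hgen := he.isGeneratedBy hK
  refine ⟨hgen, ?_⟩
  rw [← hgen.trivialFibrations_eq, cofibrations_eq_llp easy]

end EasyModel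

theorem mainTheorem8 (M : Type u) [Category.{v} M] [ModelCategory M]
    [EasyModel.IsCombinatorial.{w} M] :
    (∀ (J : Type w) [SmallCategory J] (e : J), Nonempty (IsInitial e) →
      (∀ f : Over e, f = Over.mk (𝟙 e)) →
        EasyModel.AdmitsEasyModelStructure M e) ∧
    (∀ (X : Type w) (A B : X),
      EasyModel.AdmitsEasyModelStructure M (op (EasyModel.Chain.single A B))) :=
  ⟨fun _ _ e _ _ ↦ EasyModel.admitsEasyModelStructure M e,
    fun _ _ _ ↦ EasyModel.admitsEasyModelStructure M _⟩
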